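/- Let $\mathcal A$ be a finite set with $|\mathcal A|=N$ and give $\mathcal A^{\mathbb Z}$ its product (Borel) $\sigma$-algebra. Let $\sigma:\mathcal A^{\mathbb Z}\to\mathcal A^{\mathbb Z}$ be the shift, $\sigma(\mathbf a)_z=a_{z-1}$. Let $*$ be a quasigroup operation on $\mathcal A$, that is, a binary operation such that $a*b=a*c$ implies $b=c$ and $b*a=c*a$ implies $b=c$, for all $a,b,c\in\mathcal A$. Let $\Phi:\mathcal A^{\mathbb Z}\to\mathcal A^{\mathbb Z}$ be the associated quasigroup cellular automaton, $\Phi(\mathbf a)_z=a_z*a_{z+1}$ for all $z\in\mathbb Z$ (equivalently, $\Phi$ is a bipermutative right-sided nearest-neighbour cellular automaton). Let $\mu$ be a Borel probability measure on $\mathcal A^{\mathbb Z}$ that is $\Phi$-invariant and $\sigma$-ergodic (in particular $\sigma$-invariant). Then there is an integer $K$ with $1\le K\le N$ such that: (a) $h_\mu(\Phi)=\log_2 K$, where $h_\mu(\Phi)$ is the (Kolmogorov–Sinai) entropy of the measure-preserving system $(\mathcal A^{\mathbb Z},\Phi,\mu)$, computed with base-2 logarithms: the supremum over finite measurable partitions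 $\mathfrak p$ of $\lim_{n\to\infty}\frac1n H_\mu\big(\bigvee_{t=0}^{n-1}\Phi^{-t}\mathfrak p\big)$, with $H_\mu(\mathfrak q)=-\sum_{Q\in\mathfrak q}\mu(Q)\log_2\mu(Q)$; (b) $\Phi$ is $K$-to-1 $\mu$-almost everywhere: there is a measurable set $\mathcal U\subseteq\mathcal A^{\mathbb Z}$ with $\mu(\mathcal U)=1$ such that $\mu\big(\Phi^{-1}(\mathcal U)\,\triangle\,\mathcal U\big)=0$ and, for $\mu$-almost every $\mathbf u\in\mathcal U$, $\big|\mathcal U\cap\Phi^{-1}\{\mathbf u\}\big|=K$. -/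

import Mathlib

open MeasureTheory Filter

/-! ### Quasigroups and cellular automata on `ℤ → A`

For a finite alphabet `A` with the discrete σ-algebra, the product σ-algebra on `ℤ → A` is the Borel
σ-algebra of the product of the discrete topologies. -/

/-- `op` has the left- and the right-cancellation property. -/
def IsQuasigroupOp {A : Type*} (op : A → A → A) : Prop :=
  (∀ a b c, op a b = op a c → b = c) ∧ (∀ a b c, op b a = op c a → b = c)

/-- `Φ` is the right-sided nearest-neighbour cellular automaton with local rule `φ`. -/
def IsRNNCAWith {A : Type*} (φ : A → A → A) (Φ : (ℤ → A) → (ℤ → A)) : Prop :=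
  ∀ (a : ℤ → A) (z : ℤ), Φ a z = φ (a z) (a (z + 1))

/-- `Φ` is a quasigroup cellular automaton: a right-sided nearest-neighbour cellular automaton
whose local rule is a quasigroup operation (over a finite alphabet: a bipermutative one). -/
def IsQuasigroupCA {A : Type*} (Φ : (ℤ → A) → (ℤ → A)) : Prop :=
  ∃ op : A → A → A, IsQuasigroupOp op ∧ IsRNNCAWith op Φ

/-- The shift map on `ℤ → A`, `σ(a)_z = a_{z-1}`. -/
def shiftMap {A : Type*} (a : ℤ → A) : ℤ → A := fun z => a (z - 1)

/-! ### Entropy of a measure-preserving system -/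

/-- Shannon entropy, in bits, of the finite partition of `Ω` into the fibres of `p : Ω → ι`:
`-∑ᵢ μ(p = i) log₂ μ(p = i)`, with `0 log 0 = 0`. -/
noncomputable def partitionEntropy {Ω ι : Type*} [MeasurableSpace Ω] [Fintype ι]
    (μ : Measure Ω) (p : Ω → ι) : ℝ :=
  ∑ i, Real.negMulLog (μ.real (p ⁻¹' {i})) / Real.log 2

/-- The labelling by words `(p x, p (T x), …, p (T^(n-1) x))`. Its fibres are the cells of the
refinement `⋁_{t < n} T^{-t} p`. -/
def itinerary {Ω ι : Type*} (T : Ω → Ω) (p : Ω → ι) (n : ℕ) (x : Ω) : Fin n → ι :=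
  fun t => p (T^[(t : ℕ)] x)

/-- Entropy of `T` relative to the partition `p`: the limit of `(1/n) H(⋁_{t < n} T^{-t} p)`.
For a `T`-invariant probability measure the sequence converges, by subadditivity, so that the
upper limit is the limit. -/
noncomputable def entropyOfPartition {Ω ι : Type*} [MeasurableSpace Ω] [Fintype ι]
    (μ : Measure Ω) (T : Ω → Ω) (p : Ω → ι) : EReal :=
  limsup (fun n : ℕ => ((partitionEntropy μ (itinerary T p n) / (n : ℝ) : ℝ) : EReal)) atTop

/-- Kolmogorov–Sinai entropy (base 2) of `T` with respect to `μ`: the supremum of the entropies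
relative to all finite measurable partitions, a partition into at most `k` cells being given by a
measurable labelling `p : Ω → Fin k`. -/
noncomputable def measureEntropy {Ω : Type*} [MeasurableSpace Ω] (μ : Measure Ω) (T : Ω → Ω) : EReal :=
  ⨆ (k : ℕ) (p : Ω → Fin k) (_ : Measurable p), entropyOfPartition μ T p

/-- `Φ` is `K`-to-1 `μ`-almost everywhere: there is a measurable set `U` of measure one such that
`Φ⁻¹(U)` and `U` agree up to a `μ`-null set, and `μ`-almost every `u ∈ U` has exactly `K` preimages
in `U`. -/
def IsAEKToOne {Ω : Type*} [MeasurableSpace Ω] (μ : Measure Ω) (Φ : Ω → Ω) (K : ℕ) : Prop :=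
  ∃ U : Set Ω, MeasurableSet U ∧ μ U = 1 ∧ Φ ⁻¹' U =ᵐ[μ] U ∧
    ∀ᵐ u ∂μ, u ∈ U → (U ∩ Φ ⁻¹' {u}).encard = (K : ℕ∞)

open Topology

/-! ### Shannon entropy of finite labellings -/

/-! By cancellation, a point `x` is determined by `Φ x` and the single symbol `x 0`, and every
symbol occurs, so each fibre of `Φ` is a copy of `A`. Let `η x` be the conditional probability,
given `Φ`, of the symbol that `x` has at 0. Once `Φ x` is known, `x 0` and `x (-1)` determine each
other, so `η` is shift-invariant, hence a.e. a constant `c` by ergodicity. A conditional law whose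
only values are 0 and `c` is uniform on `K = 1/c` symbols (`exists_uniform_condProb`). This gives
the `K`-to-1 property on `U = {η = 1/K}` and the value `log K` for the entropy of `x 0` given `Φ`
(`exists_isAEKToOne`).

The entropy of `Φ` is computed from the word entropies `H n`. A word of length `n + 1` carries the
same information as one symbol together with the image word of length `n`. By invariance `H (n+1) -
H n` is the entropy of that symbol given the image word, which tends to `log₂ K` by martingale
convergence (`tendsto_partitionEntropy_wordAt_succ_sub`). The itinerary of a window of length `L`
over `n` steps depends on a word of length `n + L`, and windows approximate every finite partition
(`entropyOfPartition_le`). Conversely, `n` steps of the symbol at 0 recover a word of length `n`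
(`le_measureEntropy`). -/

lemma negMulLog_sum_le {ι : Type*} (s : Finset ι) (p : ι → ℝ) (hp : ∀ i ∈ s, 0 ≤ p i) :
    Real.negMulLog (∑ i ∈ s, p i) ≤ ∑ i ∈ s, Real.negMulLog (p i) := by
  simp only [Real.negMulLog, ← Finset.sum_neg_distrib, Finset.sum_mul]
  refine Finset.sum_le_sum fun i hi => ?_
  rcases (hp i hi).eq_or_lt with h | h
  · simp [← h]
  · have hle : p i ≤ ∑ j ∈ s, p j := Finset.single_le_sum hp hi
    have := Real.log_le_log h hle
    nlinarith

/-- The entropy of a joint distribution is at most the sum of the entropies of its marginals,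
for a nonnegative mass function of any total mass. -/
lemma sum_negMulLog_add_le {ι κ : Type*} [Fintype ι] [Fintype κ] (p : ι → κ → ℝ)
    (hp : ∀ i j, 0 ≤ p i j) :
    (∑ i, ∑ j, Real.negMulLog (p i j)) + Real.negMulLog (∑ i, ∑ j, p i j) ≤
      ∑ i, Real.negMulLog (∑ j, p i j) + ∑ j, Real.negMulLog (∑ i, p i j) := by
  set a : ι → ℝ := fun i => ∑ j, p i j with ha
  set b : κ → ℝ := fun j => ∑ i, p i j with hb
  set t : ℝ := ∑ i, ∑ j, p i j with ht
  have hta : ∑ i, a i = t := rfl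
  have htb : ∑ j, b j = t := Finset.sum_comm
  have ha0 : ∀ i, 0 ≤ a i := fun i => Finset.sum_nonneg fun j _ => hp i j
  have hb0 : ∀ j, 0 ≤ b j := fun j => Finset.sum_nonneg fun i _ => hp i j
  have ht0 : 0 ≤ t := Finset.sum_nonneg fun i _ => ha0 i
  -- Gibbs' inequality: `log s ≤ s - 1` at `s = a i * b j / (p i j * t)`, weighted by `p i j`.
  have key : ∀ i j, p i j * (Real.log (a i) + Real.log (b j) - Real.log (p i j) - Real.log t) ≤
      a i * b j / t - p i j := by
    intro i j
    rcases (hp i j).eq_or_lt with h | h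
    · rw [← h]
      simpa using div_nonneg (mul_nonneg (ha0 i) (hb0 j)) ht0
    · have h1 : p i j ≤ a i := Finset.single_le_sum (fun j _ => hp i j) (Finset.mem_univ j)
      have h2 : p i j ≤ b j :=
        Finset.single_le_sum (f := fun i => p i j) (fun i _ => hp i j) (Finset.mem_univ i)
      have h3 : a i ≤ t := Finset.single_le_sum (fun i _ => ha0 i) (Finset.mem_univ i)
      have hai : 0 < a i := h.trans_le h1
      have hbj : 0 < b j := h.trans_le h2
      have htt : 0 < t := hai.trans_le h3
      have h4 := Real.log_le_sub_one_of_pos (div_pos (mul_pos hai hbj) (mul_pos h htt))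
      rw [Real.log_div (mul_pos hai hbj).ne' (mul_pos h htt).ne', Real.log_mul hai.ne' hbj.ne',
        Real.log_mul h.ne' htt.ne'] at h4
      have h5 := mul_le_mul_of_nonneg_left h4 h.le
      have h6 : p i j * (a i * b j / (p i j * t) - 1) = a i * b j / t - p i j := by
        field_simp
      linarith
  have hsum := Finset.sum_le_sum fun i (_ : i ∈ Finset.univ) =>
    Finset.sum_le_sum fun j (_ : j ∈ Finset.univ) => key i j
  have hR : ∑ i, ∑ j, (a i * b j / t - p i j) = 0 := by
    simp only [Finset.sum_sub_distrib, ← Finset.sum_div, ← Finset.mul_sum, htb, ← Finset.sum_mul,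
      hta]
    rw [mul_self_div_self, ← ht, sub_self]
  have hLa : ∑ i, ∑ j, p i j * Real.log (a i) = - ∑ i, Real.negMulLog (a i) := by
    simp [Real.negMulLog, ← Finset.sum_mul, ha]
  have hLb : ∑ i, ∑ j, p i j * Real.log (b j) = - ∑ j, Real.negMulLog (b j) := by
    rw [Finset.sum_comm]
    simp [Real.negMulLog, ← Finset.sum_mul, hb]
  have hLp : ∑ i, ∑ j, p i j * Real.log (p i j) = - ∑ i, ∑ j, Real.negMulLog (p i j) := by
    simp [Real.negMulLog]
  have hLt : ∑ i, ∑ j, p i j * Real.log t = - Real.negMulLog t := by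
    simp [Real.negMulLog, ← Finset.sum_mul, ht]
  have hL : ∑ i, ∑ j, p i j *
      (Real.log (a i) + Real.log (b j) - Real.log (p i j) - Real.log t) =
      - ∑ i, Real.negMulLog (a i) - ∑ j, Real.negMulLog (b j) +
        ∑ i, ∑ j, Real.negMulLog (p i j) + Real.negMulLog t := by
    simp only [mul_sub, mul_add, Finset.sum_sub_distrib, Finset.sum_add_distrib, hLa, hLb, hLp, hLt]
    ring
  rw [hL, hR] at hsum
  linarith

section Entropy

variable {Ω : Type*} [MeasurableSpace Ω] {μ : Measure Ω}

lemma measureReal_preimage_singleton_eq_sum [IsProbabilityMeasure μ] {ι κ : Type*} [Fintype ι]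
    [DecidableEq κ] [MeasurableSpace ι] [MeasurableSingletonClass ι]
    {X : Ω → ι} (hX : Measurable X) (g : ι → κ) (y : κ) :
    μ.real ((fun w => g (X w)) ⁻¹' {y}) = ∑ i with g i = y, μ.real (X ⁻¹' {i}) := by
  rw [← measureReal_biUnion_finset]
  · congr 1
    ext w
    simp
  · intro i _ j _ hij
    exact Disjoint.preimage _ (by simpa using hij)
  · intro i _
    exact hX (measurableSet_singleton i)

lemma partitionEntropy_comp_le [IsProbabilityMeasure μ] {ι κ : Type*} [Fintype ι] [Fintype κ]
    [MeasurableSpace ι] [MeasurableSingletonClass ι] {X : Ω → ι} (hX : Measurable X) (g : ι → κ) :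
    partitionEntropy μ (fun w => g (X w)) ≤ partitionEntropy μ X := by
  classical
  unfold partitionEntropy
  simp only [← Finset.sum_div]
  refine div_le_div_of_nonneg_right ?_ (Real.log_nonneg (by norm_num))
  simp only [measureReal_preimage_singleton_eq_sum hX g]
  refine (Finset.sum_le_sum fun y _ =>
    negMulLog_sum_le _ _ fun i _ => measureReal_nonneg).trans_eq ?_
  exact Finset.sum_fiberwise _ _ _

/-- A labelling determined by another one has smaller entropy. -/
lemma partitionEntropy_le_of_determined [IsProbabilityMeasure μ] {ι κ : Type*} [Fintype ι]
    [Fintype κ] [MeasurableSpace ι] [MeasurableSingletonClass ι] {X : Ω → ι} (hX : Measurable X)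
    {Y : Ω → κ} (h : ∀ v w, X v = X w → Y v = Y w) :
    partitionEntropy μ Y ≤ partitionEntropy μ X := by
  have : Nonempty κ := (nonempty_of_isProbabilityMeasure μ).map Y
  obtain ⟨g, rfl⟩ := (Function.factorsThrough_iff (f := X) Y).1 fun v w hvw => h v w hvw
  exact partitionEntropy_comp_le hX g

lemma partitionEntropy_eq_of_determined [IsProbabilityMeasure μ] {ι κ : Type*} [Fintype ι]
    [Fintype κ] [MeasurableSpace ι] [MeasurableSingletonClass ι] [MeasurableSpace κ]
    [MeasurableSingletonClass κ] {X : Ω → ι} (hX : Measurable X) {Y : Ω → κ} (hY : Measurable Y)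
    (h : ∀ v w, X v = X w ↔ Y v = Y w) :
    partitionEntropy μ Y = partitionEntropy μ X :=
  (partitionEntropy_le_of_determined hX fun v w => (h v w).1).antisymm
    (partitionEntropy_le_of_determined hY fun v w => (h v w).2)

lemma partitionEntropy_comp_measurePreserving {Ω' ι : Type*} [MeasurableSpace Ω']
    {ν : Measure Ω'} [Fintype ι] [MeasurableSpace ι] [MeasurableSingletonClass ι] {T : Ω → Ω'}
    (hT : MeasurePreserving T μ ν) {X : Ω' → ι} (hX : Measurable X) :
    partitionEntropy μ (fun w => X (T w)) = partitionEntropy ν X := by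
  unfold partitionEntropy
  refine Finset.sum_congr rfl fun i _ => ?_
  have : (fun w => X (T w)) ⁻¹' {i} = T ⁻¹' (X ⁻¹' {i}) := rfl
  rw [this, hT.measureReal_preimage (hX (measurableSet_singleton i)).nullMeasurableSet]

/-- Submodularity of entropy. -/
lemma partitionEntropy_submodular [IsProbabilityMeasure μ] {ι κ l : Type*} [Fintype ι] [Fintype κ]
    [Fintype l] [MeasurableSpace ι] [MeasurableSingletonClass ι] [MeasurableSpace κ]
    [MeasurableSingletonClass κ] [MeasurableSpace l] [MeasurableSingletonClass l]
    {X : Ω → ι} (hX : Measurable X) {Y : Ω → κ} (hY : Measurable Y) {Z : Ω → l}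
    (hZ : Measurable Z) :
    partitionEntropy μ (fun w => (Z w, X w, Y w)) + partitionEntropy μ Z ≤
      partitionEntropy μ (fun w => (Z w, X w)) + partitionEntropy μ (fun w => (Z w, Y w)) := by
  classical
  have hXYZ : Measurable (fun w => (Z w, X w, Y w)) := by fun_prop
  have m1 : ∀ k, μ.real (Z ⁻¹' {k}) =
      ∑ i, ∑ j, μ.real ((fun w => (Z w, X w, Y w)) ⁻¹' {(k, i, j)}) := by
    intro k
    have := measureReal_preimage_singleton_eq_sum (μ := μ) hXYZ (fun q => q.1) k
    rw [Finset.sum_filter, Fintype.sum_prod_type, Finset.sum_eq_single k (by intros; simp_all)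
      (by simp)] at this
    simpa [Fintype.sum_prod_type] using this
  have m2 : ∀ k i, μ.real ((fun w => (Z w, X w)) ⁻¹' {(k, i)}) =
      ∑ j, μ.real ((fun w => (Z w, X w, Y w)) ⁻¹' {(k, i, j)}) := by
    intro k i
    have := measureReal_preimage_singleton_eq_sum (μ := μ) hXYZ (fun q => (q.1, q.2.1)) (k, i)
    rw [Finset.sum_filter, Fintype.sum_prod_type, Finset.sum_eq_single k (by intros; simp_all)
      (by simp), Fintype.sum_prod_type, Finset.sum_eq_single i (by intros; simp_all)
      (by simp)] at this
    simpa using this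
  have m3 : ∀ k j, μ.real ((fun w => (Z w, Y w)) ⁻¹' {(k, j)}) =
      ∑ i, μ.real ((fun w => (Z w, X w, Y w)) ⁻¹' {(k, i, j)}) := by
    intro k j
    have := measureReal_preimage_singleton_eq_sum (μ := μ) hXYZ (fun q => (q.1, q.2.2)) (k, j)
    rw [Finset.sum_filter, Fintype.sum_prod_type, Finset.sum_eq_single k (by intros; simp_all)
      (by simp), Fintype.sum_prod_type, Finset.sum_congr rfl (fun i _ =>
        Finset.sum_eq_single j (by intros; simp_all) (by simp))] at this
    simpa using this
  unfold partitionEntropy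
  simp only [← Finset.sum_div, ← add_div]
  refine div_le_div_of_nonneg_right ?_ (Real.log_nonneg (by norm_num))
  simp only [Fintype.sum_prod_type, ← Finset.sum_add_distrib]
  refine Finset.sum_le_sum fun k _ => ?_
  simp only [m1, m2, m3]
  -- On the cell `Z = k` the joint law of `X` and `Y` has mass `μ(Z = k)`, not 1; hence the
  -- mass-free form of the inequality.
  exact sum_negMulLog_add_le (fun i j => μ.real ((fun w => (Z w, X w, Y w)) ⁻¹' {(k, i, j)}))
    fun _ _ => measureReal_nonneg

end Entropy

/-! ### Conditional entropy and conditional expectations -/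

section CondEntropy

variable {Ω : Type*} {mΩ : MeasurableSpace Ω} {μ : Measure Ω}

/-- Conditional probability of the set `S` given the σ-algebra `m`. -/
noncomputable def condProbOf (μ : Measure Ω) (m : MeasurableSpace Ω) (S : Set Ω) : Ω → ℝ :=
  μ[S.indicator (fun _ => (1 : ℝ)) | m]

lemma integrable_indicator_one [IsFiniteMeasure μ] {S : Set Ω} (hS : MeasurableSet S) :
    Integrable (S.indicator (fun _ => (1 : ℝ))) μ :=
  (integrable_const 1).indicator hS

lemma condProbOf_mem_Icc [IsProbabilityMeasure μ] (m : MeasurableSpace Ω) (hm : m ≤ mΩ)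
    {S : Set Ω} (hS : MeasurableSet[mΩ] S) : ∀ᵐ w ∂μ, condProbOf μ m S w ∈ Set.Icc (0 : ℝ) 1 := by
  have h0 : (0 : Ω → ℝ) ≤ᵐ[μ] condProbOf μ m S :=
    condExp_nonneg (Eventually.of_forall fun w => Set.indicator_nonneg (fun _ _ => zero_le_one) w)
  have h1 : condProbOf μ m S ≤ᵐ[μ] μ[fun _ => (1 : ℝ) | m] :=
    condExp_mono (integrable_indicator_one hS) (integrable_const 1)
      (Eventually.of_forall fun w => Set.indicator_le_self' (fun _ _ => zero_le_one) w)
  rw [condExp_const hm] at h1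
  filter_upwards [h0, h1] with w hw0 hw1 using ⟨hw0, hw1⟩

lemma integral_indicator_one_eq {s S : Set Ω} (hS : MeasurableSet S) :
    ∫ w in s, S.indicator (fun _ => (1 : ℝ)) w ∂μ = μ.real (S ∩ s) := by
  rw [integral_indicator_const _ hS, measureReal_restrict_apply hS]
  simp

lemma setIntegral_comp_finite [IsFiniteMeasure μ] {κ : Type*} [Fintype κ] [MeasurableSpace κ]
    [MeasurableSingletonClass κ] {Y : Ω → κ} (hY : Measurable Y) (G : κ → ℝ) (s : Set Ω) :
    ∫ w in s, G (Y w) ∂μ = ∑ y, μ.real (Y ⁻¹' {y} ∩ s) * G y := by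
  rw [← integral_map (f := G) hY.aemeasurable (measurable_of_finite G).aestronglyMeasurable,
    integral_fintype Integrable.of_finite]
  refine Finset.sum_congr rfl fun y _ => ?_
  rw [map_measureReal_apply hY (measurableSet_singleton y),
    measureReal_restrict_apply (hY (measurableSet_singleton y)), smul_eq_mul]

lemma measureReal_eq_sum_inter_preimage [IsFiniteMeasure μ] {κ : Type*} [Fintype κ]
    [MeasurableSpace κ] [MeasurableSingletonClass κ] {Y : Ω → κ} (hY : Measurable Y) (s : Set Ω) :
    μ.real s = ∑ y, μ.real (Y ⁻¹' {y} ∩ s) := by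
  simpa using setIntegral_comp_finite (μ := μ) hY (fun _ => 1) s

lemma condProbOf_comap_finite [IsProbabilityMeasure μ] {κ : Type*} [Fintype κ]
    [mκ : MeasurableSpace κ] [MeasurableSingletonClass κ] {Y : Ω → κ} (hY : Measurable Y)
    {S : Set Ω} (hS : MeasurableSet S) :
    condProbOf μ (mκ.comap Y) S =ᵐ[μ]
      fun w => μ.real (S ∩ Y ⁻¹' {Y w}) / μ.real (Y ⁻¹' {Y w}) := by
  set G : κ → ℝ := fun y => μ.real (S ∩ Y ⁻¹' {y}) / μ.real (Y ⁻¹' {y}) with hG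
  have hGm : Measurable G := measurable_of_finite G
  have hGi : Integrable (fun w => G (Y w)) μ :=
    (Integrable.of_finite (f := G) (μ := μ.map Y)).comp_measurable hY
  refine (ae_eq_condExp_of_forall_setIntegral_eq hY.comap_le (integrable_indicator_one hS)
    (fun _ _ _ => hGi.integrableOn) ?_ ?_).symm
  · rintro _ ⟨B, hB, rfl⟩ -
    rw [setIntegral_comp_finite hY G, integral_indicator_one_eq hS,
      measureReal_eq_sum_inter_preimage hY]
    refine Finset.sum_congr rfl fun y _ => ?_
    by_cases hy : y ∈ B
    · have h1 : Y ⁻¹' {y} ∩ Y ⁻¹' B = Y ⁻¹' {y} := by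
        ext w; simp; rintro rfl; exact hy
      have h2 : Y ⁻¹' {y} ∩ (S ∩ Y ⁻¹' B) = S ∩ Y ⁻¹' {y} := by
        rw [Set.inter_left_comm, h1]
      rw [h1, h2, hG]
      by_cases h0 : μ.real (Y ⁻¹' {y}) = 0
      · rw [h0, zero_mul]
        exact (le_antisymm ((measureReal_mono Set.inter_subset_right).trans_eq h0)
          measureReal_nonneg).symm
      · exact mul_div_cancel₀ _ h0
    · have h1 : Y ⁻¹' {y} ∩ Y ⁻¹' B = ∅ := by
        ext w; simp; rintro rfl; exact hy
      have h2 : Y ⁻¹' {y} ∩ (S ∩ Y ⁻¹' B) = ∅ := by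
        rw [Set.inter_left_comm, h1, Set.inter_empty]
      simp [h1, h2]
  · exact (hGm.comp (comap_measurable Y)).stronglyMeasurable.aestronglyMeasurable

/-- Entropy, in nats, of the finite labelling `X` given the σ-algebra `m`. -/
noncomputable def condEntropy {ι : Type*} [Fintype ι] (μ : Measure Ω) (X : Ω → ι)
    (m : MeasurableSpace Ω) : ℝ :=
  ∫ w, ∑ i, Real.negMulLog (condProbOf μ m (X ⁻¹' {i}) w) ∂μ

/-- Chain rule. -/
lemma partitionEntropy_prod_sub [IsProbabilityMeasure μ] {ι κ : Type*} [Fintype ι]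
    [MeasurableSpace ι] [MeasurableSingletonClass ι] [Fintype κ]
    [mκ : MeasurableSpace κ] [MeasurableSingletonClass κ] {X : Ω → ι} (hX : Measurable X)
    {Y : Ω → κ} (hY : Measurable Y) :
    partitionEntropy μ (fun w => (X w, Y w)) - partitionEntropy μ Y =
      condEntropy μ X (mκ.comap Y) / Real.log 2 := by
  have hS : ∀ i, MeasurableSet (X ⁻¹' {i}) := fun i => hX (measurableSet_singleton i)
  have hae : (fun w => ∑ i, Real.negMulLog (condProbOf μ (mκ.comap Y) (X ⁻¹' {i}) w)) =ᵐ[μ]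
      fun w => (fun y => ∑ i, Real.negMulLog
        (μ.real (X ⁻¹' {i} ∩ Y ⁻¹' {y}) / μ.real (Y ⁻¹' {y}))) (Y w) := by
    filter_upwards [ae_all_iff.2 fun i => condProbOf_comap_finite (μ := μ) hY (hS i)] with w hw
    exact Finset.sum_congr rfl fun i _ => by rw [hw i]
  unfold condEntropy partitionEntropy
  rw [integral_congr_ae hae, ← setIntegral_univ, setIntegral_comp_finite hY (fun y => ∑ i, Real.negMulLog
      (μ.real (X ⁻¹' {i} ∩ Y ⁻¹' {y}) / μ.real (Y ⁻¹' {y}))), ← Finset.sum_div, ← Finset.sum_div, ← sub_div]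
  congr 1
  rw [Fintype.sum_prod_type, Finset.sum_comm, ← Finset.sum_sub_distrib]
  refine Finset.sum_congr rfl fun y _ => ?_
  have hpre : ∀ i, (fun w => (X w, Y w)) ⁻¹' {(i, y)} = X ⁻¹' {i} ∩ Y ⁻¹' {y} := by
    intro i; ext w; simp
  have hsum : μ.real (Y ⁻¹' {y}) = ∑ i, μ.real (X ⁻¹' {i} ∩ Y ⁻¹' {y}) :=
    measureReal_eq_sum_inter_preimage hX _
  simp only [hpre, Set.inter_univ]
  rcases eq_or_ne (μ.real (Y ⁻¹' {y})) 0 with h0 | h0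
  · have : ∀ i, μ.real (X ⁻¹' {i} ∩ Y ⁻¹' {y}) = 0 := fun i =>
      le_antisymm ((measureReal_mono Set.inter_subset_right).trans_eq h0) measureReal_nonneg
    simp [this, h0]
  · set t := μ.real (Y ⁻¹' {y})
    -- Summed over `i`, the second term is `negMulLog t`, which cancels the contribution of the cell
    -- to the entropy of `Y`.
    have hterm : ∀ i, Real.negMulLog (μ.real (X ⁻¹' {i} ∩ Y ⁻¹' {y})) =
        t * Real.negMulLog (μ.real (X ⁻¹' {i} ∩ Y ⁻¹' {y}) / t) +
          (μ.real (X ⁻¹' {i} ∩ Y ⁻¹' {y}) / t) * Real.negMulLog t := by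
      intro i
      rw [← Real.negMulLog_mul, div_mul_cancel₀ _ h0]
    simp only [hterm, Finset.sum_add_distrib, ← Finset.sum_mul, ← Finset.sum_div, ← hsum,
      div_self h0, one_mul, add_sub_cancel_right, Finset.mul_sum]

/-- Lévy's upward theorem gives a.e. convergence of the conditional probabilities; they lie in `[0,
1]`, where `negMulLog` is bounded by 1, so dominated convergence applies. -/
lemma tendsto_condEntropy [IsProbabilityMeasure μ] {ι : Type*} [Fintype ι]
    [MeasurableSpace ι] [MeasurableSingletonClass ι] {X : Ω → ι} (hX : Measurable X)
    (ℱ : Filtration ℕ mΩ) :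
    Tendsto (fun n => condEntropy μ X (ℱ n)) atTop (𝓝 (condEntropy μ X (⨆ n, ℱ n))) := by
  have hS : ∀ i, MeasurableSet (X ⁻¹' {i}) := fun i => hX (measurableSet_singleton i)
  refine tendsto_integral_of_dominated_convergence (fun _ => (Fintype.card ι : ℝ)) ?_
    (integrable_const _) ?_ ?_
  · intro n
    have : ∀ i, StronglyMeasurable (condProbOf μ (ℱ n) (X ⁻¹' {i})) := fun i =>
      stronglyMeasurable_condExp.mono (ℱ.le n)
    exact (Finset.stronglyMeasurable_fun_sum _ fun i _ =>
      Real.continuous_negMulLog.comp_stronglyMeasurable (this i)).aestronglyMeasurable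
  · intro n
    filter_upwards [ae_all_iff.2 fun i => condProbOf_mem_Icc (μ := μ) (ℱ n) (ℱ.le n) (hS i)]
      with w hw
    refine (norm_sum_le _ _).trans ?_
    refine (Finset.sum_le_card_nsmul _ _ 1 fun i _ => ?_).trans_eq (by simp)
    rw [Real.norm_of_nonneg (Real.negMulLog_nonneg (hw i).1 (hw i).2)]
    exact (Real.negMulLog_le_one_sub_self (hw i).1).trans (by linarith [(hw i).1])
  · filter_upwards [ae_all_iff.2 fun i =>
      tendsto_ae_condExp (μ := μ) (ℱ := ℱ) ((X ⁻¹' {i}).indicator fun _ => (1 : ℝ))] with w hw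
    exact tendsto_finsetSum _ fun i _ => (Real.continuous_negMulLog.tendsto _).comp (hw i)

/-- Entropy given an increasing sequence of finite labellings converges to the entropy given the
σ-algebra they generate. -/
lemma tendsto_partitionEntropy_prod_sub [IsProbabilityMeasure μ] {ι : Type*} [Fintype ι]
    [MeasurableSpace ι] [MeasurableSingletonClass ι] {X : Ω → ι} (hX : Measurable X)
    {κ : ℕ → Type*} [∀ n, Fintype (κ n)] [mκ : ∀ n, MeasurableSpace (κ n)]
    [∀ n, MeasurableSingletonClass (κ n)] {Y : ∀ n, Ω → κ n} (hY : ∀ n, Measurable (Y n))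
    (hmono : Monotone fun n => (mκ n).comap (Y n)) :
    Tendsto (fun n => partitionEntropy μ (fun w => (X w, Y n w)) - partitionEntropy μ (Y n)) atTop
      (𝓝 (condEntropy μ X (⨆ n, (mκ n).comap (Y n)) / Real.log 2)) := by
  let ℱ : Filtration ℕ mΩ := ⟨fun n => (mκ n).comap (Y n), hmono, fun n => (hY n).comap_le⟩
  simp only [fun n => partitionEntropy_prod_sub (μ := μ) hX (hY n)]
  exact (tendsto_condEntropy (μ := μ) hX ℱ).div_const _

lemma condEntropy_self [IsProbabilityMeasure μ]
    {ι : Type*} [Fintype ι] [MeasurableSpace ι] [MeasurableSingletonClass ι] {X : Ω → ι}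
    (hX : Measurable X) : condEntropy μ X mΩ = 0 := by
  unfold condEntropy
  refine (integral_congr_ae (Eventually.of_forall fun w => ?_)).trans (integral_zero Ω ℝ)
  refine Finset.sum_eq_zero fun i _ => ?_
  have hS : MeasurableSet (X ⁻¹' {i}) := hX (measurableSet_singleton i)
  rw [condProbOf, condExp_of_stronglyMeasurable le_rfl
    (stronglyMeasurable_const.indicator hS) (integrable_indicator_one hS)]
  by_cases hw : w ∈ X ⁻¹' {i} <;> simp [hw]

end CondEntropy

/-! ### Preimages of quasigroup cellular automata -/

section Automaton

variable {A : Type*} {op : A → A → A} {Φ : (ℤ → A) → (ℤ → A)}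

/-- One known symbol spreads over the interval: left cancellation carries it to the right, right
cancellation to the left. -/
lemma IsRNNCAWith.eq_on_interval (hop : IsQuasigroupOp op) (hΦ : IsRNNCAWith op Φ)
    {x y : ℤ → A} {a b k : ℤ} (hak : a ≤ k) (hkb : k ≤ b) (hk : x k = y k)
    (h : ∀ z, a ≤ z → z < b → Φ x z = Φ y z) (z : ℤ) (haz : a ≤ z) (hzb : z ≤ b) : x z = y z := by
  have right : ∀ n : ℕ, k + n ≤ b → x (k + n) = y (k + n) := by
    intro n
    induction n with
    | zero => intro _; simpa using hk
    | succ n ih =>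
      intro hn
      push_cast at hn ⊢
      have h1 := ih (by lia)
      have h2 := h (k + n) (by lia) (by lia)
      rw [hΦ, hΦ, h1] at h2
      rw [← add_assoc]
      exact hop.1 _ _ _ h2
  have left : ∀ n : ℕ, a ≤ k - n → x (k - n) = y (k - n) := by
    intro n
    induction n with
    | zero => intro _; simpa using hk
    | succ n ih =>
      intro hn
      push_cast at hn ⊢
      have h1 := ih (by lia)
      have h2 := h (k - (n + 1)) (by lia) (by lia)
      rw [hΦ, hΦ, show k - (n + 1 : ℤ) + 1 = k - n by ring, h1] at h2
      exact hop.2 _ _ _ h2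
  rcases le_total k z with hz | hz
  · have := right (z - k).toNat (by lia)
    rwa [show k + ((z - k).toNat : ℤ) = z by lia] at this
  · have := left (k - z).toNat (by lia)
    rwa [show k - ((k - z).toNat : ℤ) = z by lia] at this

lemma IsRNNCAWith.eq_of_apply_zero (hop : IsQuasigroupOp op) (hΦ : IsRNNCAWith op Φ)
    {x y : ℤ → A} (h0 : x 0 = y 0) (h : Φ x = Φ y) : x = y := by
  funext z
  exact hΦ.eq_on_interval hop (a := -|z|) (b := |z|) (by simp) (by simp) h0
    (fun w _ _ => congrFun h w) z (neg_abs_le z) (le_abs_self z)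

lemma IsRNNCAWith.exists_preimage [Finite A] (hop : IsQuasigroupOp op) (hΦ : IsRNNCAWith op Φ)
    (i : A) (u : ℤ → A) : ∃ x, x 0 = i ∧ Φ x = u := by
  have hr : ∀ a c, ∃ b, op a b = c := fun a =>
    Finite.surjective_of_injective (hop.1 a)
  have hl : ∀ b c, ∃ a, op a b = c := fun b =>
    Finite.surjective_of_injective (hop.2 b)
  choose r hr using hr
  choose l hl using hl
  let R : ℕ → A := fun n => Nat.rec i (fun n a => r a (u n)) n
  let L : ℕ → A := fun n => Nat.rec i (fun n b => l b (u (-(n + 1)))) n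
  refine ⟨fun z => if 0 ≤ z then R z.toNat else L (-z).toNat, rfl, ?_⟩
  funext z
  rw [hΦ]
  rcases le_or_gt 0 z with hz | hz
  · obtain ⟨n, rfl⟩ := Int.eq_ofNat_of_zero_le hz
    have h1 : ((n : ℤ) + 1).toNat = n + 1 := by lia
    simp only [Int.natCast_nonneg, if_true, Int.toNat_natCast, show (0 : ℤ) ≤ n + 1 by lia, h1]
    exact hr _ _
  · obtain ⟨n, hn⟩ := Int.eq_ofNat_of_zero_le (show 0 ≤ -z - 1 by lia)
    obtain rfl : z = -(n + 1) := by lia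
    have h1 : (-(-((n : ℤ) + 1))).toNat = n + 1 := by lia
    have h2 : (-(-((n : ℤ) + 1) + 1)).toNat = n := by lia
    -- The two halves meet at 0: for `n = 0` the right neighbour lies in the `R` branch, but `R 0 =
    -- L 0 = i`.
    have h3 : (if 0 ≤ -((n : ℤ) + 1) + 1 then R (-((n : ℤ) + 1) + 1).toNat
        else L (-(-((n : ℤ) + 1) + 1)).toNat) = L n := by
      rw [h2]
      split_ifs with h
      · obtain rfl : n = 0 := by lia
        rfl
      · rfl
    rw [h3, if_neg (by lia), h1]
    exact hl _ _

lemma IsRNNCAWith.comp_shiftMap (hΦ : IsRNNCAWith op Φ) (x : ℤ → A) :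
    Φ (shiftMap x) = shiftMap (Φ x) := by
  funext z
  simp only [shiftMap, hΦ _ _]
  congr 2
  ring

end Automaton

/-! ### Conditional probabilities along a measure-preserving map -/

section CondProb

variable {Ω : Type*} {mΩ : MeasurableSpace Ω} {μ : Measure Ω} [IsProbabilityMeasure μ]

lemma condProbOf_inter {m : MeasurableSpace Ω} {C E : Set Ω} (hC : MeasurableSet[m] C)
    (hE : MeasurableSet[mΩ] E) :
    condProbOf μ m (C ∩ E) =ᵐ[μ] C.indicator (condProbOf μ m E) := by
  unfold condProbOf
  rw [← Set.indicator_indicator]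
  exact condExp_indicator (integrable_indicator_one hE) hC

lemma condProbOf_sum {ι : Type*} (s : Finset ι) {m : MeasurableSpace Ω} {E : ι → Set Ω}
    {S : Set Ω} (hE : ∀ i ∈ s, MeasurableSet[mΩ] (E i))
    (hS : S.indicator (fun _ => (1 : ℝ)) = ∑ i ∈ s, (E i).indicator (fun _ => (1 : ℝ))) :
    condProbOf μ m S =ᵐ[μ] ∑ i ∈ s, condProbOf μ m (E i) := by
  unfold condProbOf
  rw [hS]
  exact condExp_finsetSum (fun i hi => integrable_indicator_one (hE i hi)) m

/-- Conditional probabilities given `Φ` are equivariant under an invertible measure-preserving map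
that commutes with `Φ`. -/
lemma condProbOf_comp {Φ S T : Ω → Ω} (hΦ : Measurable Φ) (hS : MeasurePreserving S μ μ)
    (hT : Measurable T) (hTS : ∀ x, T (S x) = x) (hcomm : ∀ x, Φ (S x) = S (Φ x))
    {E : Set Ω} (hE : MeasurableSet E) :
    condProbOf μ (mΩ.comap Φ) E ∘ S =ᵐ[μ] condProbOf μ (mΩ.comap Φ) (S ⁻¹' E) := by
  have hint : Integrable (condProbOf μ (mΩ.comap Φ) E) μ := integrable_condExp
  refine ae_eq_condExp_of_forall_setIntegral_eq hΦ.comap_le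
    (integrable_indicator_one (hS.measurable hE))
    (fun _ _ _ => ((hS.integrable_comp hint.aestronglyMeasurable).2 hint).integrableOn) ?_ ?_
  · rintro _ ⟨B, hB, rfl⟩ -
    -- The inverse `T` exhibits every event of the conditioning σ-algebra as the `S`-preimage of
    -- another one.
    have h1 : Φ ⁻¹' B = S ⁻¹' (Φ ⁻¹' (T ⁻¹' B)) := by
      ext x; simp [hcomm, hTS]
    have hm : MeasurableSet[mΩ.comap Φ] (Φ ⁻¹' (T ⁻¹' B)) := ⟨_, hT hB, rfl⟩
    have hm' : MeasurableSet (Φ ⁻¹' (T ⁻¹' B)) := hΦ.comap_le _ hm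
    have h2 := setIntegral_map (μ := μ) hm' (f := condProbOf μ (mΩ.comap Φ) E)
      (by rw [hS.map_eq]; exact hint.aestronglyMeasurable) hS.measurable.aemeasurable
    rw [integral_indicator_one_eq (hS.measurable hE), h1, ← Set.preimage_inter,
      hS.measureReal_preimage (hE.inter hm').nullMeasurableSet, ← integral_indicator_one_eq hE]
    refine h2.symm.trans ?_
    rw [hS.map_eq]
    exact setIntegral_condExp hΦ.comap_le (integrable_indicator_one hE) hm
  · obtain ⟨g, hg, hgf⟩ := (stronglyMeasurable_condExp (μ := μ) (m := mΩ.comap Φ)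
      (f := E.indicator fun _ => (1 : ℝ))).measurable.exists_eq_measurable_comp
    have : condProbOf μ (mΩ.comap Φ) E ∘ S = (g ∘ S) ∘ Φ := by
      funext x
      have := congrFun hgf (S x)
      simp only [Function.comp_apply, hcomm] at this ⊢
      exact this
    rw [this]
    exact ((hg.comp hS.measurable).comp
      (comap_measurable Φ)).stronglyMeasurable.aestronglyMeasurable

end CondProb

/-! ### The fibre structure -/

section Fibre

variable {A : Type*} [Fintype A] [MeasurableSpace A] [DiscreteMeasurableSpace A]
  {op : A → A → A} {Φ : (ℤ → A) → (ℤ → A)} {μ : Measure (ℤ → A)} [IsProbabilityMeasure μ]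

lemma measurableSet_apply_eq {B : Type*} [MeasurableSpace B] [MeasurableSingletonClass B] (z : ℤ)
    (i : B) : MeasurableSet {y : ℤ → B | y z = i} :=
  (measurable_pi_apply z : Measurable fun y : ℤ → B => y z) (measurableSet_singleton i)

/-- The event `y (-1) = j` is the disjoint union over `i` of `y 0 = i` and `Φ y (-1) = op j i`. The
second condition is measurable with respect to `Φ`, so it comes out as an indicator. -/
lemma condProbOf_apply_shiftMap (hop : IsQuasigroupOp op) (hΦ : IsRNNCAWith op Φ)
    (hmeas : Measurable Φ) (hS : MeasurePreserving (shiftMap : (ℤ → A) → (ℤ → A)) μ μ) (j : A) :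
    ∀ᵐ x ∂μ, condProbOf μ (MeasurableSpace.pi.comap Φ) {y | y 0 = j} (shiftMap x) =
      ∑ i, {y | Φ y (-1) = op j i}.indicator
        (condProbOf μ (MeasurableSpace.pi.comap Φ) {y | y 0 = i}) x := by
  classical
  have hE : ∀ (z : ℤ) (i : A), MeasurableSet {y : ℤ → A | y z = i} :=
    measurableSet_apply_eq
  have hC : ∀ i, MeasurableSet[MeasurableSpace.pi.comap Φ] {y | Φ y (-1) = op j i} := fun i =>
    ⟨_, hE (-1) (op j i), rfl⟩
  have hT : Measurable fun (x : ℤ → A) (z : ℤ) => x (z + 1) := by fun_prop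
  have h1 := condProbOf_comp hmeas hS hT (fun x => by funext z; simp [shiftMap])
    hΦ.comp_shiftMap (hE 0 j)
  have h2 := condProbOf_sum (μ := μ) Finset.univ (m := MeasurableSpace.pi.comap Φ)
    (E := fun i => {y | Φ y (-1) = op j i} ∩ {y | y 0 = i}) (S := shiftMap ⁻¹' {y | y 0 = j})
    (fun i _ => (hmeas.comap_le _ (hC i)).inter (hE 0 i)) (by
      funext x
      rw [Finset.sum_apply, Finset.sum_eq_single (x 0)]
      · by_cases hx : x (-1) = j
        · simp [shiftMap, hx, hΦ x (-1)]
        · have : ¬ op (x (-1)) (x 0) = op j (x 0) := fun h => hx (hop.2 _ _ _ h)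
          simp [shiftMap, hx, hΦ x (-1), this]
      · intro i _ hi
        simp [Ne.symm hi]
      · simp)
  filter_upwards [h1, h2, ae_all_iff.2 fun i => condProbOf_inter (μ := μ) (hC i) (hE 0 i)]
    with x h1 h2 h3
  rw [← Function.comp_apply (f := condProbOf _ _ _), h1, h2, Finset.sum_apply]
  exact Finset.sum_congr rfl fun i _ => h3 i

/-- The conditional law of the zeroth coordinate given the image under `Φ` is almost surely uniform
on a set of constant cardinality. -/
lemma exists_uniform_condProb (hop : IsQuasigroupOp op) (hΦ : IsRNNCAWith op Φ)
    (hinv : MeasurePreserving Φ μ μ) (herg : Ergodic (shiftMap : (ℤ → A) → (ℤ → A)) μ) :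
    ∃ (K : ℕ) (g : A → (ℤ → A) → ℝ), 1 ≤ K ∧ (∀ i, Measurable (g i)) ∧
      (∀ i, condProbOf μ (MeasurableSpace.pi.comap Φ) {y | y 0 = i} = g i ∘ Φ) ∧
      (∀ᵐ x ∂μ, g (x 0) (Φ x) = (K : ℝ)⁻¹) ∧
      ∀ᵐ u ∂μ, (∀ i, g i u = 0 ∨ g i u = (K : ℝ)⁻¹) ∧ {i | g i u = (K : ℝ)⁻¹}.ncard = K := by
  classical
  have hE : ∀ (i : A), MeasurableSet {y : ℤ → A | y 0 = i} :=
    measurableSet_apply_eq 0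
  have hle := hinv.measurable.comap_le
  have hex : ∀ i, ∃ g : (ℤ → A) → ℝ, Measurable g ∧
      condProbOf μ (MeasurableSpace.pi.comap Φ) {y | y 0 = i} = g ∘ Φ := fun i =>
    (stronglyMeasurable_condExp (μ := μ) (m := MeasurableSpace.pi.comap Φ)
      (f := {y : ℤ → A | y 0 = i}.indicator
        fun _ => (1 : ℝ))).measurable.exists_eq_measurable_comp
  choose g hg hgf using hex
  have hηm : Measurable fun x : ℤ → A => g (x 0) (Φ x) := by
    have : (fun x : ℤ → A => g (x 0) (Φ x)) =
        fun x => ∑ i, {y : ℤ → A | y 0 = i}.indicator (fun y => g i (Φ y)) x := by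
      funext x
      rw [Finset.sum_eq_single (x 0) (fun i _ hi => by simp [Ne.symm hi]) (by simp)]
      simp
    rw [this]
    exact Finset.measurable_fun_sum _ fun i _ => ((hg i).comp hinv.measurable).indicator (hE i)
  -- Shift-invariance of `η`: with `j = x (-1)`, left cancellation leaves only the term `i = x 0` of
  -- the sum.
  obtain ⟨c, hc⟩ : ∃ c, (fun x : ℤ → A => g (x 0) (Φ x)) =ᵐ[μ] Function.const _ c := by
    refine herg.ae_eq_const_of_ae_eq_comp_ae hηm.aestronglyMeasurable ?_
    filter_upwards [ae_all_iff.2 fun j =>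
      condProbOf_apply_shiftMap (μ := μ) hop hΦ hinv.measurable herg.toMeasurePreserving j]
      with x hx
    have h1 := hx (shiftMap x 0)
    rw [hgf] at h1
    refine h1.trans ?_
    rw [Finset.sum_eq_single (x 0)]
    · rw [Set.indicator_of_mem, hgf, Function.comp_apply]
      rw [Set.mem_ofPred_eq, hΦ]
      rfl
    · intro i _ hi
      refine Set.indicator_of_notMem (fun h => hi ?_) _
      rw [Set.mem_ofPred_eq, hΦ] at h
      exact (hop.1 _ _ _ h).symm
    · simp
  have hsum : ∀ᵐ x ∂μ, ∑ i, g i (Φ x) = 1 := by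
    have := condProbOf_sum (μ := μ) Finset.univ (m := MeasurableSpace.pi.comap Φ)
      (E := fun i => {y : ℤ → A | y 0 = i}) (S := Set.univ) (fun i _ => hE i) (by
        funext x
        rw [Finset.sum_apply, Finset.sum_eq_single (x 0) (fun i _ hi => by simp [Ne.symm hi])
          (by simp)]
        simp)
    rw [condProbOf, Set.indicator_univ, condExp_const hle] at this
    filter_upwards [this] with x hx
    rw [Finset.sum_apply] at hx
    simpa [hgf] using hx.symm
  have hzero : ∀ i, ∀ᵐ x ∂μ, g i (Φ x) = 0 ∨ g i (Φ x) = c := by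
    intro i
    have hB : MeasurableSet {u | g i u ≠ c} := (hg i) (measurableSet_singleton c).compl
    have hB' : MeasurableSet (Φ ⁻¹' {u | g i u ≠ c}) := hinv.measurable hB
    -- The integral is the measure of the set where `x 0 = i` and `η x ≠ c`, which is null.
    have h0 : ∫ x in Φ ⁻¹' {u | g i u ≠ c}, g i (Φ x) ∂μ = 0 := by
      have h1 : ∫ x in Φ ⁻¹' {u | g i u ≠ c},
          condProbOf μ (MeasurableSpace.pi.comap Φ) {y | y 0 = i} x ∂μ = _ :=
        setIntegral_condExp hle (integrable_indicator_one (hE i)) ⟨_, hB, rfl⟩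
      rw [integral_indicator_one_eq (hE i), hgf] at h1
      refine h1.trans ?_
      rw [measureReal_def, measure_eq_zero_iff_ae_notMem.2, ENNReal.toReal_zero]
      filter_upwards [hc] with x hx
      rintro ⟨rfl, h⟩
      exact h hx
    have hnn : ∀ᵐ x ∂μ, 0 ≤ g i (Φ x) := by
      filter_upwards [condProbOf_mem_Icc (μ := μ) _ hle (hE i)] with x hx
      rw [hgf] at hx
      exact hx.1
    have hint : Integrable (fun x => g i (Φ x)) μ := by
      have : Integrable (condProbOf μ (MeasurableSpace.pi.comap Φ) {y | y 0 = i}) μ :=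
        integrable_condExp
      rwa [hgf] at this
    rw [setIntegral_eq_zero_iff_of_nonneg_ae (ae_restrict_of_ae hnn) hint.integrableOn,
      EventuallyEq, ae_restrict_iff' hB'] at h0
    filter_upwards [h0] with x hx
    by_cases h : g i (Φ x) = c
    · exact Or.inr h
    · exact Or.inl (hx h)
  have hcount : ∀ u : ℤ → A, (∀ i, g i u = 0 ∨ g i u = c) → ∑ i, g i u = 1 →
      ({i | g i u = c}.ncard : ℝ) * c = 1 := by
    intro u h1 h2
    rw [Set.ncard_eq_toFinset_card', ← nsmul_eq_mul, ← Finset.sum_const, ← h2]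
    refine (Finset.sum_congr rfl fun i hi => ?_).trans
      (Finset.sum_subset (Finset.subset_univ _) fun i _ hi => ?_)
    · exact (by simpa using hi : g i u = c).symm
    · exact (h1 i).resolve_right (by simpa using hi)
  have hall : ∀ᵐ u ∂μ, (∀ i, g i u = 0 ∨ g i u = c) ∧ ∑ i, g i u = 1 := by
    have hPm : MeasurableSet {u | (∀ i, g i u = 0 ∨ g i u = c) ∧ ∑ i, g i u = 1} := by
      have h1 : MeasurableSet {u | ∀ i, g i u = 0 ∨ g i u = c} := by
        rw [Set.ofPred_forall]
        exact MeasurableSet.iInter fun i =>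
          (hg i (measurableSet_singleton 0)).union (hg i (measurableSet_singleton c))
      exact h1.inter
        ((Finset.measurable_fun_sum Finset.univ fun i _ => hg i) (measurableSet_singleton 1))
    -- Since `Φ` preserves `μ`, what holds at `Φ x` for almost every `x` holds at almost every `u`.
    rw [← hinv.map_eq, ae_map_iff hinv.measurable.aemeasurable hPm]
    filter_upwards [ae_all_iff.2 hzero, hsum] with x h1 h2 using ⟨h1, h2⟩
  -- The count at one typical point suffices: count times `c` is 1 at all typical points.
  obtain ⟨u₀, h1, h2⟩ := hall.exists
  have hK := hcount u₀ h1 h2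
  set K := {i | g i u₀ = c}.ncard
  have hK0 : (K : ℝ) ≠ 0 := fun h => by simp [h] at hK
  have hcK : c = (K : ℝ)⁻¹ := eq_inv_of_mul_eq_one_right hK
  refine ⟨K, g, Nat.one_le_iff_ne_zero.2 (by exact_mod_cast hK0), hg, hgf, hcK ▸ hc, ?_⟩
  filter_upwards [hall] with u hu
  rw [← hcK]
  refine ⟨hu.1, ?_⟩
  have := hcount u hu.1 hu.2
  rw [hcK, mul_inv_eq_one₀ hK0] at this
  rw [hcK]
  exact_mod_cast this

/-- A quasigroup cellular automaton is almost everywhere `K`-to-one, and `log K` is the conditional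
entropy of the zeroth coordinate given the image. -/
lemma exists_isAEKToOne (hop : IsQuasigroupOp op) (hΦ : IsRNNCAWith op Φ)
    (hinv : MeasurePreserving Φ μ μ) (herg : Ergodic (shiftMap : (ℤ → A) → (ℤ → A)) μ) :
    ∃ K : ℕ, 1 ≤ K ∧ K ≤ Fintype.card A ∧ IsAEKToOne μ Φ K ∧
      condEntropy μ (fun x : ℤ → A => x 0) (MeasurableSpace.pi.comap Φ) = Real.log K := by
  classical
  obtain ⟨K, g, hK, hg, hgf, hη, hu⟩ := exists_uniform_condProb (μ := μ) hop hΦ hinv herg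
  refine ⟨K, hK, ?_, ?_, ?_⟩
  · obtain ⟨u, -, h⟩ := hu.exists
    rw [← h, ← Nat.card_eq_fintype_card, ← Set.ncard_univ]
    exact Set.ncard_le_ncard (Set.subset_univ _)
  · have hUm : MeasurableSet {x : ℤ → A | g (x 0) (Φ x) = (K : ℝ)⁻¹} := by
      have : {x : ℤ → A | g (x 0) (Φ x) = (K : ℝ)⁻¹} =
          ⋃ i, {x | x 0 = i} ∩ {x | g i (Φ x) = (K : ℝ)⁻¹} := by
        ext x; simp
      rw [this]
      exact MeasurableSet.iUnion fun i =>
        (measurableSet_apply_eq 0 i).inter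
          ((hg i).comp hinv.measurable (measurableSet_singleton _))
    have hU1 : μ {x : ℤ → A | g (x 0) (Φ x) = (K : ℝ)⁻¹} = 1 :=
      (prob_compl_eq_zero_iff hUm).1 hη
    have hUae : {x : ℤ → A | g (x 0) (Φ x) = (K : ℝ)⁻¹} =ᵐ[μ] Set.univ := eventuallyEq_univ.2 hη
    refine ⟨_, hUm, hU1, ?_, ?_⟩
    · exact (hinv.quasiMeasurePreserving.preimage_ae_eq hUae).trans hUae.symm
    · filter_upwards [hu] with u hu _
      -- The symbol at 0 identifies the part of the fibre lying in `U` with the `K` symbols of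
      -- positive conditional probability.
      have hinj : Set.InjOn (fun x : ℤ → A => x 0)
          ({x : ℤ → A | g (x 0) (Φ x) = (K : ℝ)⁻¹} ∩ Φ ⁻¹' {u}) := fun x hx y hy h =>
        hΦ.eq_of_apply_zero hop h (hx.2.trans hy.2.symm)
      have himg : (fun x : ℤ → A => x 0) ''
          ({x : ℤ → A | g (x 0) (Φ x) = (K : ℝ)⁻¹} ∩ Φ ⁻¹' {u}) = {i | g i u = (K : ℝ)⁻¹} := by
        ext i
        constructor
        · rintro ⟨x, ⟨hx, rfl⟩, rfl⟩
          exact hx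
        · intro hi
          obtain ⟨x, rfl, rfl⟩ := hΦ.exists_preimage hop i u
          exact ⟨x, ⟨hi, rfl⟩, rfl⟩
      rw [← hinj.encard_image, himg, ← (Set.toFinite _).cast_ncard_eq, hu.2]
  · have hae : (fun x => ∑ i, Real.negMulLog (condProbOf μ (MeasurableSpace.pi.comap Φ)
        ((fun x : ℤ → A => x 0) ⁻¹' {i}) x)) =ᵐ[μ] fun _ => Real.log K := by
      filter_upwards [hinv.quasiMeasurePreserving.ae hu] with x hx
      have hK0 : (K : ℝ) ≠ 0 := by positivity
      have hterm : ∀ i, Real.negMulLog (condProbOf μ (MeasurableSpace.pi.comap Φ)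
          ((fun x : ℤ → A => x 0) ⁻¹' {i}) x) =
          if g i (Φ x) = (K : ℝ)⁻¹ then (K : ℝ)⁻¹ * Real.log K else 0 := by
        intro i
        have : condProbOf μ (MeasurableSpace.pi.comap Φ) ((fun x : ℤ → A => x 0) ⁻¹' {i}) x =
          g i (Φ x) := congrFun (hgf i) x
        rw [this]
        split_ifs with h
        · rw [h, Real.negMulLog, Real.log_inv]
          ring
        · rw [(hx.1 i).resolve_right h, Real.negMulLog_zero]
      have hcard := hx.2
      rw [Set.ncard_eq_toFinset_card', Set.toFinset_ofPred] at hcard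
      simp only [hterm]
      rw [← Finset.sum_filter, Finset.sum_const, hcard, nsmul_eq_mul, mul_inv_cancel_left₀ hK0]
    rw [condEntropy, integral_congr_ae hae]
    simp

end Fibre

/-! ### Entropy relative to two partitions -/

section Itinerary

variable {Ω : Type*} [MeasurableSpace Ω] {μ : Measure Ω}

omit [MeasurableSpace Ω] in
lemma itinerary_eq_iff {ι : Type*} {T : Ω → Ω} {p : Ω → ι} {n : ℕ} {v w : Ω} :
    itinerary T p n v = itinerary T p n w ↔ ∀ t < n, p (T^[t] v) = p (T^[t] w) :=
  ⟨fun h t ht => congrFun h ⟨t, ht⟩, fun h => funext fun t => h t t.2⟩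

omit [MeasurableSpace Ω] in
lemma itinerary_succ_eq_iff {ι : Type*} {T : Ω → Ω} {p : Ω → ι} {n : ℕ} {v w : Ω} :
    itinerary T p (n + 1) v = itinerary T p (n + 1) w ↔
      itinerary T p n v = itinerary T p n w ∧ p (T^[n] v) = p (T^[n] w) := by
  simp only [itinerary_eq_iff]
  exact Nat.forall_lt_succ_right

lemma measurable_itinerary {ι : Type*} [MeasurableSpace ι] {T : Ω → Ω} (hT : Measurable T)
    {p : Ω → ι} (hp : Measurable p) (n : ℕ) : Measurable (itinerary T p n) :=
  measurable_pi_iff.2 fun t => hp.comp (hT.iterate t)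

/-- In conditional form, `H(pⁿ | qⁿ) ≤ ∑ H(p ∘ T^t | q ∘ T^t) = n H(p | q)`. -/
lemma partitionEntropy_itinerary_le [IsProbabilityMeasure μ] {ι κ : Type*} [Fintype ι] [Fintype κ]
    [MeasurableSpace ι] [MeasurableSingletonClass ι] [MeasurableSpace κ]
    [MeasurableSingletonClass κ] {T : Ω → Ω} (hT : MeasurePreserving T μ μ)
    {p : Ω → ι} (hp : Measurable p) {q : Ω → κ} (hq : Measurable q) (n : ℕ) :
    partitionEntropy μ (fun w => (itinerary T p n w, itinerary T q n w)) ≤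
      partitionEntropy μ (itinerary T q n) +
        n * (partitionEntropy μ (fun w => (p w, q w)) - partitionEntropy μ q) := by
  have hP := measurable_itinerary hT.measurable hp
  have hQ := measurable_itinerary hT.measurable hq
  induction n with
  | zero =>
    simp only [Nat.cast_zero, zero_mul, add_zero]
    exact partitionEntropy_le_of_determined (hQ 0) fun v w _ =>
      Prod.ext (Subsingleton.elim _ _) (Subsingleton.elim _ _)
  | succ n ih =>
    have hTn : MeasurePreserving T^[n] μ μ := hT.iterate n
    have hp' : Measurable fun w => p (T^[n] w) := hp.comp hTn.measurable
    have hq' : Measurable fun w => q (T^[n] w) := hq.comp hTn.measurable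
    -- `s1` splits off the last `p`-label given the `q`-itinerary of length `n + 1`; `s2` and `s3`
    -- shrink the conditioning to the last `q`-label and to the first `n` ones. The `d` inequalities
    -- only rearrange tuples.
    have s1 := partitionEntropy_submodular (μ := μ) (hP n) hp' (hQ (n + 1))
    have s2 := partitionEntropy_submodular (μ := μ) hp' (hQ n) hq'
    have s3 := partitionEntropy_submodular (μ := μ) (hP n) hq' (hQ n)
    have d1 : partitionEntropy μ (fun w => (itinerary T p (n + 1) w, itinerary T q (n + 1) w)) ≤
        partitionEntropy μ (fun w => (itinerary T q (n + 1) w, itinerary T p n w, p (T^[n] w))) :=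
      partitionEntropy_le_of_determined ((hQ _).prodMk ((hP n).prodMk hp')) fun v w h => by
        simp only [Prod.mk.injEq] at h ⊢
        exact ⟨(itinerary_succ_eq_iff (p := p)).2 h.2, h.1⟩
    have d2 : partitionEntropy μ (fun w => (itinerary T q (n + 1) w, p (T^[n] w))) ≤
        partitionEntropy μ (fun w => (q (T^[n] w), p (T^[n] w), itinerary T q n w)) :=
      partitionEntropy_le_of_determined (hq'.prodMk (hp'.prodMk (hQ n))) fun v w h => by
        simp only [Prod.mk.injEq] at h ⊢
        exact ⟨(itinerary_succ_eq_iff (p := q)).2 ⟨h.2.2, h.1⟩, h.2.1⟩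
    have d3 : partitionEntropy μ (fun w => (q (T^[n] w), itinerary T q n w)) ≤
        partitionEntropy μ (itinerary T q (n + 1)) :=
      partitionEntropy_le_of_determined (hQ _) fun v w h => by
        have := (itinerary_succ_eq_iff (p := q)).1 h
        simp only [Prod.mk.injEq]
        exact ⟨this.2, this.1⟩
    have d4 : partitionEntropy μ (fun w => (itinerary T q (n + 1) w, itinerary T p n w)) ≤
        partitionEntropy μ (fun w => (itinerary T q n w, itinerary T p n w, q (T^[n] w))) :=
      partitionEntropy_le_of_determined ((hQ n).prodMk ((hP n).prodMk hq')) fun v w h => by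
        simp only [Prod.mk.injEq] at h ⊢
        exact ⟨(itinerary_succ_eq_iff (p := q)).2 ⟨h.1, h.2.2⟩, h.2.1⟩
    have d5 : partitionEntropy μ (fun w => (itinerary T q n w, q (T^[n] w))) ≤
        partitionEntropy μ (itinerary T q (n + 1)) :=
      partitionEntropy_le_of_determined (hQ _) fun v w h => by
        have := (itinerary_succ_eq_iff (p := q)).1 h
        simp only [Prod.mk.injEq]
        exact this
    have d6 : partitionEntropy μ (fun w => (itinerary T q n w, itinerary T p n w)) ≤
        partitionEntropy μ (fun w => (itinerary T p n w, itinerary T q n w)) :=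
      partitionEntropy_le_of_determined ((hP n).prodMk (hQ n)) fun v w h => by
        simp only [Prod.mk.injEq] at h ⊢
        exact h.symm
    have e1 : partitionEntropy μ (fun w => q (T^[n] w)) = partitionEntropy μ q :=
      partitionEntropy_comp_measurePreserving hTn hq
    have e2 : partitionEntropy μ (fun w => (q (T^[n] w), p (T^[n] w))) ≤
        partitionEntropy μ (fun w => (p w, q w)) := by
      rw [← partitionEntropy_comp_measurePreserving hTn
        (X := fun w => (p w, q w)) (by fun_prop)]
      exact partitionEntropy_le_of_determined (hp'.prodMk hq') fun v w h => by
        simp only [Prod.mk.injEq] at h ⊢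
        exact h.symm
    push_cast
    linarith

end Itinerary

/-! ### Words -/

/-- The word of length `n` of `x` that starts at `s`. -/
def wordAt {A : Type*} (s : ℤ) (n : ℕ) (x : ℤ → A) : Fin n → A := fun i => x (s + i)

section Word

variable {A : Type*}

lemma wordAt_eq_iff {s : ℤ} {n : ℕ} {x y : ℤ → A} :
    wordAt s n x = wordAt s n y ↔ ∀ z, s ≤ z → z < s + n → x z = y z := by
  refine ⟨fun h z h1 h2 => ?_, fun h => funext fun i => h _ (by lia) (by have := i.isLt; lia)⟩
  have := congrFun h ⟨(z - s).toNat, by lia⟩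
  simp only [wordAt] at this
  rwa [show s + ((z - s).toNat : ℤ) = z by lia] at this

/-- Each step looks one cell to the right and none to the left, so the dependence grows on one side
only. -/
lemma IsRNNCAWith.iterate_eq_of_eq {op : A → A → A} {Φ : (ℤ → A) → (ℤ → A)}
    (hΦ : IsRNNCAWith op Φ) {a b : ℤ} (t : ℕ) {x y : ℤ → A}
    (h : ∀ z, a ≤ z → z < b + t → x z = y z) (z : ℤ) (haz : a ≤ z) (hzb : z < b) :
    Φ^[t] x z = Φ^[t] y z := by
  induction t generalizing x y with
  | zero => exact h z haz (by simpa using hzb)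
  | succ t ih =>
    push_cast at h
    rw [Function.iterate_succ_apply, Function.iterate_succ_apply]
    refine ih fun z h1 h2 => ?_
    rw [hΦ, hΦ, h z h1 (by lia), h (z + 1) (by lia) (by lia)]

/-- Induction on `Φ x`: its orbit at 0 gives `Φ x` on `[0, n)`, and `x 0` then gives `x` on `[0,
n]`. -/
lemma IsRNNCAWith.eq_of_iterate_eq {op : A → A → A} (hop : IsQuasigroupOp op)
    {Φ : (ℤ → A) → (ℤ → A)} (hΦ : IsRNNCAWith op Φ) (n : ℕ) {x y : ℤ → A}
    (h : ∀ t < n, Φ^[t] x 0 = Φ^[t] y 0) (z : ℤ) (h0 : 0 ≤ z) (hz : z < n) : x z = y z := by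
  induction n generalizing x y z with
  | zero => lia
  | succ n ih =>
    push_cast at hz
    have h1 : ∀ z, 0 ≤ z → z < (n : ℤ) → Φ x z = Φ y z := fun z hz0 hzn =>
      ih (fun t ht => by simpa using h (t + 1) (by lia)) z hz0 hzn
    exact hΦ.eq_on_interval hop (b := n) (k := 0) le_rfl (by lia) (h 0 (by lia)) h1 z h0 (by lia)

variable [MeasurableSpace A]

lemma measurable_wordAt (s : ℤ) (n : ℕ) : Measurable (wordAt (A := A) s n) :=
  measurable_pi_iff.2 fun _ => measurable_pi_apply _

lemma measurable_apply_comap_wordAt {s z : ℤ} {n : ℕ} (h1 : s ≤ z) (h2 : z < s + n) :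
    Measurable[MeasurableSpace.pi.comap (wordAt s n)] fun x : ℤ → A => x z := by
  have : (fun x : ℤ → A => x z) =
      (fun v : Fin n → A => v ⟨(z - s).toNat, by lia⟩) ∘ wordAt s n := by
    funext x
    simp only [wordAt, Function.comp_apply]
    congr 1
    lia
  rw [this]
  exact (measurable_pi_apply _).comp (comap_measurable _)

/-- Starting at `-⌊n/2⌋`, the windows are nested, grow by one cell at a time, and exhaust `ℤ`. -/
lemma monotone_comap_wordAt :
    Monotone fun n : ℕ => MeasurableSpace.pi.comap (wordAt (A := A) (-((n / 2 : ℕ) : ℤ)) n) := by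
  refine monotone_nat_of_le_succ fun n => Measurable.comap_le ?_
  exact (@measurable_pi_iff _ _ _ (_) _ _).2 fun i =>
    measurable_apply_comap_wordAt (by lia) (by have := i.isLt; lia)

lemma iSup_comap_wordAt :
    ⨆ n : ℕ, MeasurableSpace.pi.comap (wordAt (A := A) (-((n / 2 : ℕ) : ℤ)) n) =
      MeasurableSpace.pi := by
  refine le_antisymm (iSup_le fun n => (measurable_wordAt _ _).comap_le) (iSup_le fun z => ?_)
  refine le_trans (Measurable.comap_le ?_) (le_iSup _ (2 * z.natAbs + 2))
  exact measurable_apply_comap_wordAt (by lia) (by lia)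

variable [Fintype A] [DiscreteMeasurableSpace A] {μ : Measure (ℤ → A)} [IsProbabilityMeasure μ]

omit [IsProbabilityMeasure μ] in
lemma partitionEntropy_wordAt (hS : MeasurePreserving (shiftMap : (ℤ → A) → (ℤ → A)) μ μ)
    (s : ℤ) (n : ℕ) : partitionEntropy μ (wordAt s n) = partitionEntropy μ (wordAt 0 n) := by
  have step : ∀ s : ℤ, partitionEntropy μ (wordAt (A := A) (s - 1) n) =
      partitionEntropy μ (wordAt s n) := by
    intro s
    rw [← partitionEntropy_comp_measurePreserving hS (measurable_wordAt s n)]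
    congr 1
    funext x i
    simp only [wordAt, shiftMap]
    congr 1
    ring
  induction s using Int.induction_on with
  | zero => rfl
  | succ k ih => rw [← ih, ← step, add_sub_cancel_right]
  | pred k ih => rw [step, ih]

end Word

/-- Cesàro means of the telescoping increments; the initial value `u L` is negligible. -/
lemma tendsto_shift_div_of_tendsto_sub {u : ℕ → ℝ} {c : ℝ}
    (h : Tendsto (fun n => u (n + 1) - u n) atTop (𝓝 c)) (L : ℕ) :
    Tendsto (fun n : ℕ => u (n + L) / (n : ℝ)) atTop (𝓝 c) := by
  have h1 := ((tendsto_add_atTop_iff_nat L).2 h).cesaro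
  have h2 := (tendsto_const_div_atTop_nhds_zero_nat (u L)).add h1
  rw [zero_add] at h2
  refine h2.congr fun n => ?_
  have h3 := Finset.sum_range_sub (fun i => u (i + L)) n
  simp only [Nat.add_right_comm _ 1 L, zero_add] at h3
  rw [h3]
  ring

/-! ### Growth of word entropies and the entropy of the automaton -/

section Main

variable {A : Type*} [Fintype A] [MeasurableSpace A] [DiscreteMeasurableSpace A]
  {op : A → A → A} {Φ : (ℤ → A) → (ℤ → A)} {μ : Measure (ℤ → A)} [IsProbabilityMeasure μ]

/-- The word entropies grow at the rate of the conditional entropy of a coordinate given the image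
under `Φ`. -/
lemma tendsto_partitionEntropy_wordAt_succ_sub (hop : IsQuasigroupOp op) (hΦ : IsRNNCAWith op Φ)
    (hinv : MeasurePreserving Φ μ μ)
    (hS : MeasurePreserving (shiftMap : (ℤ → A) → (ℤ → A)) μ μ) :
    Tendsto (fun n : ℕ => partitionEntropy μ (wordAt (A := A) 0 (n + 1)) -
      partitionEntropy μ (wordAt (A := A) 0 n)) atTop
      (𝓝 (condEntropy μ (fun x : ℤ → A => x 0) (MeasurableSpace.pi.comap Φ) / Real.log 2)) := by
  have hcomap : ∀ n : ℕ, MeasurableSpace.pi.comap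
      (fun x : ℤ → A => wordAt (-((n / 2 : ℕ) : ℤ)) n (Φ x)) =
      (MeasurableSpace.pi.comap (wordAt (-((n / 2 : ℕ) : ℤ)) n)).comap Φ := fun n => by
    rw [MeasurableSpace.comap_comp]
    rfl
  have hm : ∀ n : ℕ, Measurable fun x : ℤ → A => wordAt (-((n / 2 : ℕ) : ℤ)) n (Φ x) := fun n =>
    (measurable_wordAt _ n).comp hinv.measurable
  have := tendsto_partitionEntropy_prod_sub (μ := μ) (X := fun x : ℤ → A => x 0)
    (measurable_pi_apply 0) hm (fun m n hmn => by
      simp only [hcomap]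
      exact MeasurableSpace.comap_mono (monotone_comap_wordAt hmn))
  simp only [hcomap, ← MeasurableSpace.comap_iSup, iSup_comap_wordAt] at this
  refine this.congr fun n => ?_
  -- Invariance under `Φ` and the shift replaces the image word by any word of length `n`.
  rw [partitionEntropy_comp_measurePreserving hinv (measurable_wordAt _ n),
    partitionEntropy_wordAt hS, ← partitionEntropy_wordAt hS (-((n / 2 : ℕ) : ℤ)) (n + 1)]
  congr 1
  refine partitionEntropy_eq_of_determined (measurable_wordAt _ _)
    ((measurable_pi_apply 0).prodMk (hm n)) fun v w => ?_
  simp only [Prod.mk.injEq, wordAt_eq_iff]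
  push_cast
  constructor
  · intro h
    refine ⟨h 0 (by lia) (by lia), fun z h1 h2 => ?_⟩
    rw [hΦ, hΦ, h z h1 (by lia), h (z + 1) (by lia) (by lia)]
  · rintro ⟨h0, h⟩ z h1 h2
    exact hΦ.eq_on_interval hop (k := 0) (b := -((n : ℤ) / 2) + n) (by lia) (by lia) h0 h z h1
      (by lia)

/-- Replacing `p` by a central window of length `L` costs at most `δ = H(p | window)` per step, and
`δ → 0` because the windows generate the σ-algebra. -/
lemma entropyOfPartition_le (hΦ : IsRNNCAWith op Φ) (hinv : MeasurePreserving Φ μ μ)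
    (hS : MeasurePreserving (shiftMap : (ℤ → A) → (ℤ → A)) μ μ) {c : ℝ}
    (h : Tendsto (fun n : ℕ => partitionEntropy μ (wordAt (A := A) 0 (n + 1)) -
      partitionEntropy μ (wordAt (A := A) 0 n)) atTop (𝓝 c))
    {ι : Type*} [Fintype ι] [MeasurableSpace ι] [MeasurableSingletonClass ι] {p : (ℤ → A) → ι}
    (hp : Measurable p) : entropyOfPartition μ Φ p ≤ (c : EReal) := by
  set q : ∀ L : ℕ, (ℤ → A) → (Fin L → A) := fun L => wordAt (-((L / 2 : ℕ) : ℤ)) L with hq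
  have hqm : ∀ L, Measurable (q L) := fun L => measurable_wordAt _ _
  have hδ : Tendsto (fun L => partitionEntropy μ (fun w => (p w, q L w)) -
      partitionEntropy μ (q L)) atTop (𝓝 0) := by
    have := tendsto_partitionEntropy_prod_sub (μ := μ) hp hqm monotone_comap_wordAt
    rwa [iSup_comap_wordAt, condEntropy_self hp, zero_div] at this
  have hlim := (continuous_coe_real_ereal.tendsto _).comp (hδ.const_add c)
  rw [add_zero] at hlim
  refine ge_of_tendsto' hlim fun L => ?_
  set δ := partitionEntropy μ (fun w => (p w, q L w)) - partitionEntropy μ (q L)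
  have hbound : Tendsto (fun n : ℕ => ((partitionEntropy μ (wordAt (A := A) 0 (n + L)) / (n : ℝ) + δ
      : ℝ) : EReal)) atTop (𝓝 ((c + δ : ℝ) : EReal)) :=
    (continuous_coe_real_ereal.tendsto _).comp
      ((tendsto_shift_div_of_tendsto_sub
        (u := fun n => partitionEntropy μ (wordAt (A := A) 0 n)) h L).add_const δ)
  refine (limsup_le_limsup ?_).trans_eq hbound.limsup_eq
  filter_upwards [eventually_gt_atTop 0] with n hn
  have hn' : (0 : ℝ) < n := by exact_mod_cast hn
  rw [EReal.coe_le_coe_iff, div_add' _ _ _ hn'.ne']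
  refine div_le_div_of_nonneg_right ?_ hn'.le
  have hPm := measurable_itinerary hinv.measurable hp n
  have hQm := measurable_itinerary hinv.measurable (hqm L) n
  have h1 : partitionEntropy μ (itinerary Φ p n) ≤
      partitionEntropy μ (fun w => (itinerary Φ p n w, itinerary Φ (q L) n w)) :=
    partitionEntropy_le_of_determined (hPm.prodMk hQm) fun v w h => congrArg Prod.fst h
  have h2 := partitionEntropy_itinerary_le hinv hp (hqm L) n
  have h3 : partitionEntropy μ (itinerary Φ (q L) n) ≤
      partitionEntropy μ (wordAt (A := A) 0 (n + L)) := by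
    rw [← partitionEntropy_wordAt hS (-((L / 2 : ℕ) : ℤ)) (n + L)]
    refine partitionEntropy_le_of_determined (measurable_wordAt _ _) fun v w hvw => ?_
    rw [wordAt_eq_iff] at hvw
    refine itinerary_eq_iff.2 fun t ht => wordAt_eq_iff.2 fun z h1 h2 => ?_
    exact hΦ.iterate_eq_of_eq t (fun z h1 h2 => hvw z h1 (by push_cast at h2 ⊢; lia)) z h1 h2
  linarith [mul_comm δ n]

lemma le_measureEntropy (hop : IsQuasigroupOp op) (hΦ : IsRNNCAWith op Φ)
    (hinv : MeasurePreserving Φ μ μ) {c : ℝ}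
    (h : Tendsto (fun n : ℕ => partitionEntropy μ (wordAt (A := A) 0 (n + 1)) -
      partitionEntropy μ (wordAt (A := A) 0 n)) atTop (𝓝 c)) :
    (c : EReal) ≤ measureEntropy μ Φ := by
  -- The partition by the symbol at 0, relabelled by `Fin`.
  set p : (ℤ → A) → Fin (Fintype.card A) := fun x => Fintype.equivFin A (x 0) with hp
  have hpm : Measurable p := Measurable.of_discrete.comp (measurable_pi_apply 0)
  refine le_trans ?_ (le_iSup_of_le (Fintype.card A) (le_iSup₂ (α := EReal)
    (f := fun (p : (ℤ → A) → Fin (Fintype.card A)) (_ : Measurable p) => entropyOfPartition μ Φ p)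
    p hpm))
  have hlim := (continuous_coe_real_ereal.tendsto _).comp (tendsto_shift_div_of_tendsto_sub
        (u := fun n => partitionEntropy μ (wordAt (A := A) 0 n)) h 0)
  refine hlim.limsup_eq.symm.trans_le (limsup_le_limsup (Eventually.of_forall fun n => ?_))
  simp only [Function.comp_apply, EReal.coe_le_coe_iff]
  refine div_le_div_of_nonneg_right ?_ n.cast_nonneg
  refine partitionEntropy_le_of_determined (measurable_itinerary hinv.measurable hpm n)
    fun v w hvw => wordAt_eq_iff.2 fun z h1 h2 => ?_
  refine hΦ.eq_of_iterate_eq hop n (fun t ht => ?_) z h1 (by simpa using h2)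
  exact (Fintype.equivFin A).injective (itinerary_eq_iff.1 hvw t ht)

end Main

theorem theorem4p1 {A : Type*} [Fintype A] [MeasurableSpace A] [DiscreteMeasurableSpace A]
    (Φ : (ℤ → A) → (ℤ → A)) (hΦ : IsQuasigroupCA Φ)
    (μ : Measure (ℤ → A)) [IsProbabilityMeasure μ]
    (hinv : MeasurePreserving Φ μ μ)
    (herg : Ergodic (shiftMap : (ℤ → A) → (ℤ → A)) μ) :
    ∃ K : ℕ, 1 ≤ K ∧ K ≤ Fintype.card A ∧
      measureEntropy μ Φ = ((Real.logb 2 (K : ℝ) : ℝ) : EReal) ∧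
      IsAEKToOne μ Φ K := by
  obtain ⟨op, hop, hΦ⟩ := hΦ
  obtain ⟨K, hK1, hKN, hto, hent⟩ := exists_isAEKToOne (μ := μ) hop hΦ hinv herg
  have hlim := tendsto_partitionEntropy_wordAt_succ_sub hop hΦ hinv herg.toMeasurePreserving
  rw [hent] at hlim
  refine ⟨K, hK1, hKN, le_antisymm ?_ (le_measureEntropy hop hΦ hinv hlim), hto⟩
  exact iSup_le fun k => iSup₂_le fun p hp =>
    entropyOfPartition_le hΦ hinv herg.toMeasurePreserving hlim hp
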